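/- Let $(\Omega,\mathcal F,\mathbb P)$ be a probability space with a filtration $\mathbb F=(\mathcal F_t)_{t\ge 0}$, and let $d\ge 1$, $n\ge 0$ be integers. Let $X$ be a càdlàg Markov chain with respect to $\mathbb F$ whose states are the standard basis vectors $e_1,\dots,e_d$ of $\mathbb R^d$, with intensity matrix $Q\in\mathbb R^{d\times d}$, where for $i\ne j$ the entry $Q_{ij}\ge 0$ is the intensity of a transition from state $j$ to state $i$ and the columns of $Q$ sum to zero; thus $\mathbb E[X_t\mid\mathcal F_s]=\exp(Q(t-s))X_s$ a.s. for $0\le s\le t$. Write $x(0)=\mathbb E X_0$. Let $\lambda\in\mathbb R^d$ have nonnegative entries. Let $\tau^1,\dots,\tau^n$ be $[0,\infty]$-valued $\mathbb F$-stopping times (the default times of $n$ obligors), and let $N_t=\sum_{i=1}^n \mathbf 1_{\{\tau^i\le t\}}$ be the number of defaults up to time $t$. Assume that $N_0=0$ a.s., that a.s. no two of the $\tau^i$ take the same finite value, that a.s. $X$ and $N$ have no common jump times, and that $$N_t=\int_0^t \lambda^\top X_s\,(n-N_s)\,\mathrm ds+m_t,\qquad t\ge 0,$$ where $m$ is a martingale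 with respect to $\mathbb F$. For $k=0,1,2,\dots$ put $Q_{k\lambda}=Q-k\,\mathrm{diag}(\lambda)$. Then for all $t\ge 0$ and $u\in\mathbb R$ the $\mathbb C^d$-valued random vector $\exp(\mathrm i uN_t)X_t$ is integrable, and its expectation $\phi(t,u)=\mathbb E[\exp(\mathrm i uN_t)X_t]$ is $$\phi(t,u)=\sum_{k=0}^n\binom nk e^{\mathrm i uk}\,(1-e^{\mathrm i u})^{n-k}\exp\big(Q_{(n-k)\lambda}\,t\big)\,x(0)$$ (with the convention $0^0=1$). -/

import Mathlib

open MeasureTheory Filter Topology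
open scoped NNReal Matrix

noncomputable section

namespace MMDefault

/-- `Q` is the intensity matrix of a finite-state Markov chain, `Q i j` (`i ≠ j`) being the intensity
of a transition from state `j` to state `i`; hence the *columns* of `Q` sum to zero. -/
structure IsIntensityMatrix {d : ℕ} (Q : Matrix (Fin d) (Fin d) ℝ) : Prop where
  nonneg_offDiag : ∀ i j, i ≠ j → 0 ≤ Q i j
  colSum_eq_zero : ∀ j, ∑ i, Q i j = 0

/-- `X` is a càdlàg continuous-time Markov chain with respect to the filtration `𝔽`, with intensity
matrix `Q` and with the standard basis vectors of `ℝ^d` as its states. Because `X t` is the vector of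
the indicators of the states, its conditional expectation is the vector of the conditional
probabilities of the states. -/
structure IsMarkovChain {Ω : Type*} {mΩ : MeasurableSpace Ω} (P : Measure Ω)
    (𝔽 : Filtration ℝ≥0 mΩ) {d : ℕ} (Q : Matrix (Fin d) (Fin d) ℝ)
    (X : ℝ≥0 → Ω → (Fin d → ℝ)) : Prop where
  intensity : IsIntensityMatrix Q
  basis_valued : ∀ t ω, ∃ j, X t ω = Pi.single j 1
  adapted : StronglyAdapted 𝔽 X
  right_continuous : ∀ ω t, ContinuousWithinAt (fun s => X s ω) (Set.Ici t) t
  left_limits : ∀ ω t, ∃ l, Tendsto (fun s => X s ω) (𝓝[<] t) (𝓝 l)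
  markov : ∀ s t : ℝ≥0, s ≤ t →
    P[X t | 𝔽 s] =ᵐ[P] fun ω => NormedSpace.exp (((t : ℝ) - (s : ℝ)) • Q) *ᵥ X s ω

/-- The default indicator `Y_t = 1_{τ ≤ t}` of an obligor with default time `τ`
(`τ = ⊤` means that the obligor never defaults). -/
def defaultIndicator {Ω : Type*} (τ : Ω → WithTop ℝ≥0) (t : ℝ≥0) (ω : Ω) : ℕ :=
  open Classical in if τ ω ≤ (t : WithTop ℝ≥0) then 1 else 0

/-- The number of defaults `N_t = ∑ i, Y^i_t` up to and including time `t`. -/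
def defaultCount {Ω : Type*} {n : ℕ} (τ : Fin n → Ω → WithTop ℝ≥0) (t : ℝ≥0) (ω : Ω) : ℕ :=
  ∑ i, defaultIndicator (τ i) t ω

/-- The process `m_t = N_t - ∫₀ᵗ (λᵀ X_s) (n - N_s) ds`. -/
def compensatedCount {Ω : Type*} {d n : ℕ} (lam : Fin d → ℝ) (X : ℝ≥0 → Ω → (Fin d → ℝ))
    (τ : Fin n → Ω → WithTop ℝ≥0) (t : ℝ≥0) (ω : Ω) : ℝ :=
  (defaultCount τ t ω : ℝ) -
    ∫ s in (0 : ℝ)..(t : ℝ),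
      (lam ⬝ᵥ X s.toNNReal ω) * ((n : ℝ) - (defaultCount τ s.toNNReal ω : ℝ))

/-- The Markov-modulated model for the defaults of `n` obligors, on a probability space with
filtration `𝔽`: a Markov chain `X` with intensity matrix `Q`, a vector `lam` of nonnegative default
rates, and default times `τ i` such that the number of defaults `N` is a counting process started
at `0` (no two obligors default simultaneously) which has no jump in common with `X` and satisfies
`dN_t = λᵀ X_t (n - N_t) dt + dm_t` with a martingale `m`. -/
structure IsModel {Ω : Type*} {mΩ : MeasurableSpace Ω} (P : Measure Ω)
    (𝔽 : Filtration ℝ≥0 mΩ) {d n : ℕ} (Q : Matrix (Fin d) (Fin d) ℝ) (lam : Fin d → ℝ)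
    (X : ℝ≥0 → Ω → (Fin d → ℝ)) (τ : Fin n → Ω → WithTop ℝ≥0) : Prop where
  chain : IsMarkovChain P 𝔽 Q X
  rate_nonneg : ∀ j, 0 ≤ lam j
  stopping : ∀ i, IsStoppingTime 𝔽 (τ i)
  count_zero : ∀ᵐ ω ∂P, defaultCount τ 0 ω = 0
  no_simultaneous_defaults : ∀ᵐ ω ∂P, ∀ i j, i ≠ j → τ i ω = τ j ω → τ i ω = ⊤
  no_common_jumps : ∀ᵐ ω ∂P, ∀ t : ℝ≥0,
    ContinuousAt (fun s => X s ω) t ∨ ContinuousAt (fun s => defaultCount τ s ω) t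
  martingale : Martingale (compensatedCount lam X τ) 𝔽 P

/-- The matrix `Q_{kλ} = Q - k diag(λ)`. -/
def Qmod {d : ℕ} (Q : Matrix (Fin d) (Fin d) ℝ) (lam : Fin d → ℝ) (k : ℕ) :
    Matrix (Fin d) (Fin d) ℝ :=
  Q - (k : ℝ) • Matrix.diagonal lam

/-- The vector `x(0) = 𝔼 X_0` of the initial probabilities of the chain (equal to `X_0` when the
initial state is deterministic). -/
def initialVector {Ω : Type*} {mΩ : MeasurableSpace Ω} (P : Measure Ω) {d : ℕ}
    (X : ℝ≥0 → Ω → (Fin d → ℝ)) : Fin d → ℝ :=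
  ∫ ω, X 0 ω ∂P

/-- A real vector regarded as a complex one. -/
def toComplex {d : ℕ} (v : Fin d → ℝ) : Fin d → ℂ := fun j => (v j : ℂ)

/-- The random vector `exp(i u N_t) X_t` in `ℂ^d`. -/
def phiIntegrand {Ω : Type*} {d n : ℕ} (X : ℝ≥0 → Ω → (Fin d → ℝ))
    (τ : Fin n → Ω → WithTop ℝ≥0) (t : ℝ≥0) (u : ℝ) (ω : Ω) : Fin d → ℂ :=
  Complex.exp (Complex.I * (u : ℂ) * (defaultCount τ t ω : ℂ)) • toComplex (X t ω)

/-- `φ(t, u) = 𝔼 [exp(i u N_t) X_t]`. -/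
def phi {Ω : Type*} {mΩ : MeasurableSpace Ω} (P : Measure Ω) {d n : ℕ}
    (X : ℝ≥0 → Ω → (Fin d → ℝ)) (τ : Fin n → Ω → WithTop ℝ≥0) (t : ℝ≥0) (u : ℝ) : Fin d → ℂ :=
  ∫ ω, phiIntegrand X τ t u ω ∂P

end MMDefault

end

/-! For fixed `k` let g(N) = C(n-N, k). It is an eigenfunction of the pure death generator: (g(N+1)
- g(N)) (n - N) = -k g(N) (`choose_sub_succ_sub_mul`). Since X takes basis vectors as values, (λᵀX)
X = diag(λ) X. As X and N do not jump together, f(t) = E[g(N_t) X_t] therefore solves the closed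
linear equation f' = (Q - k diag λ) f, so f(t) = exp(Q_{kλ} t) g(0) x(0) (`countMoment_eq`).
Expanding z^N = z^N (z + (1-z))^(n-N) with z = exp(iu) writes the required expectation as a
combination of these moments (`pow_eq_sum_choose_sub`).

The differential equation is replaced by a sum over a grid. On [s, t], g(N_t) X_t = g(N_s) X_t +
(g(N_s+1) - g(N_s)) X_s (N_t - N_s) + R. The Markov property evaluates the mean of the first term,
the martingale property that of the second up to O((t-s)²). Path by path, R vanishes on all
sufficiently short intervals, because N has unit jumps at which X is constant; and |R| is at most a
constant times N_t - N_s, whose sum over the grid telescopes. Dominated convergence then makes the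
total mean remainder tend to 0 (`tendsto_sum_integral_abs_incrementRemainder`). -/

noncomputable section

namespace MMDefault

/-! ### Paths of the default count -/

section Counting

variable {Ω : Type*} {n : ℕ} (τ : Fin n → Ω → WithTop ℝ≥0)

theorem defaultCount_le (t : ℝ≥0) (ω : Ω) : defaultCount τ t ω ≤ n := by
  unfold defaultCount
  refine (Finset.sum_le_card_nsmul _ _ 1 fun i _ => ?_).trans (by simp)
  unfold defaultIndicator
  split_ifs <;> simp

theorem defaultCount_mono {s t : ℝ≥0} (hst : s ≤ t) (ω : Ω) :
    defaultCount τ s ω ≤ defaultCount τ t ω := by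
  refine Finset.sum_le_sum fun i _ => ?_
  unfold defaultIndicator
  split_ifs with h1 h2
  · exact le_rfl
  · exact absurd (h1.trans (WithTop.coe_le_coe.2 hst)) h2
  · exact Nat.zero_le _
  · exact le_rfl

theorem measurable_defaultCount {mΩ : MeasurableSpace Ω} {𝔽 : Filtration ℝ≥0 mΩ}
    {τ : Fin n → Ω → WithTop ℝ≥0}
    (hτ : ∀ i, IsStoppingTime 𝔽 (τ i)) (t : ℝ≥0) : Measurable[𝔽 t] (defaultCount τ t) := by
  unfold defaultCount
  refine Finset.measurable_fun_sum _ fun i _ => ?_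
  unfold defaultIndicator
  exact Measurable.ite (hτ i t) measurable_const measurable_const

theorem eventually_nhdsGE_le_iff (c : WithTop ℝ≥0) (t : ℝ≥0) :
    ∀ᶠ s : ℝ≥0 in 𝓝[≥] t, (c ≤ (s : WithTop ℝ≥0) ↔ c ≤ (t : WithTop ℝ≥0)) := by
  cases c with
  | top =>
    exact Eventually.of_forall fun s => iff_of_false (not_le.2 (WithTop.coe_lt_top s))
      (not_le.2 (WithTop.coe_lt_top t))
  | coe c =>
    simp only [WithTop.coe_le_coe]
    rcases le_or_gt c t with h | h
    · filter_upwards [self_mem_nhdsWithin] with s hs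
      exact ⟨fun _ => h, fun _ => h.trans hs⟩
    · filter_upwards [mem_nhdsWithin_of_mem_nhds (Iio_mem_nhds h)] with s hs
      exact ⟨fun h' => absurd h' (not_le.2 hs), fun h' => absurd h' (not_le.2 h)⟩

theorem eventually_nhdsLT_le_iff (c : WithTop ℝ≥0) (t : ℝ≥0) :
    ∀ᶠ s : ℝ≥0 in 𝓝[<] t, (c ≤ (s : WithTop ℝ≥0) ↔ c < (t : WithTop ℝ≥0)) := by
  cases c with
  | top =>
    exact Eventually.of_forall fun s => iff_of_false (not_le.2 (WithTop.coe_lt_top s)) not_top_lt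
  | coe c =>
    simp only [WithTop.coe_le_coe, WithTop.coe_lt_coe]
    rcases lt_or_ge c t with h | h
    · filter_upwards [mem_nhdsWithin_of_mem_nhds (Ioi_mem_nhds h)] with s hs
      exact ⟨fun _ => h, fun _ => le_of_lt hs⟩
    · filter_upwards [self_mem_nhdsWithin] with s hs
      exact ⟨fun h' => absurd (h.trans h') (not_le.2 hs), fun h' => absurd h (not_le.2 h')⟩

/-- The number of defaults strictly before time `t`. -/
def defaultCountLeft (t : ℝ≥0) (ω : Ω) : ℕ :=
  open Classical in ∑ i, if τ i ω < (t : WithTop ℝ≥0) then 1 else 0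

theorem eventually_nhdsGE_defaultCount (t : ℝ≥0) (ω : Ω) :
    ∀ᶠ s in 𝓝[≥] t, defaultCount τ s ω = defaultCount τ t ω := by
  have := eventually_all.2 fun i => eventually_nhdsGE_le_iff (τ i ω) t
  filter_upwards [this] with s hs
  simp only [defaultCount, defaultIndicator, hs]

theorem eventually_nhdsLT_defaultCount (t : ℝ≥0) (ω : Ω) :
    ∀ᶠ s in 𝓝[<] t, defaultCount τ s ω = defaultCountLeft τ t ω := by
  have := eventually_all.2 fun i => eventually_nhdsLT_le_iff (τ i ω) t
  filter_upwards [this] with s hs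
  simp only [defaultCount, defaultIndicator, defaultCountLeft, hs]

/-- The jump at `t` counts the obligors with default time exactly `t`; two of them would share a
finite default time. -/
theorem defaultCount_le_defaultCountLeft_add_one {ω : Ω}
    (hω : ∀ i j, i ≠ j → τ i ω = τ j ω → τ i ω = ⊤) (t : ℝ≥0) :
    defaultCount τ t ω ≤ defaultCountLeft τ t ω + 1 := by
  classical
  have h1 : defaultCount τ t ω
      = defaultCountLeft τ t ω + ∑ i, if τ i ω = (t : WithTop ℝ≥0) then 1 else 0 := by
    simp only [defaultCount, defaultIndicator, defaultCountLeft, ← Finset.sum_add_distrib]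
    refine Finset.sum_congr rfl fun i _ => ?_
    rcases lt_trichotomy (τ i ω) t with h | h | h
    · rw [if_pos h.le, if_pos h, if_neg h.ne]
    · rw [if_pos h.le, if_neg h.not_lt, if_pos h, zero_add]
    · rw [if_neg h.not_ge, if_neg h.not_gt, if_neg h.ne']
  rw [h1]
  gcongr
  rw [← Finset.card_filter]
  refine Finset.card_le_one.2 fun i hi j hj => ?_
  simp only [Finset.mem_filter, Finset.mem_univ, true_and] at hi hj
  by_contra hij
  exact WithTop.coe_ne_top (hi.symm.trans (hω i j hij (hi.trans hj.symm)))

end Counting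

/-- The point of the grid of mesh `1 / (m + 1)` that follows `t`. -/
def gridCeil (m : ℕ) (t : ℝ≥0) : ℝ≥0 := (⌈t * ((m : ℝ≥0) + 1)⌉₊ : ℝ≥0) / ((m : ℝ≥0) + 1)

theorem tendsto_gridCeil (t : ℝ≥0) : Tendsto (fun m => gridCeil m t) atTop (𝓝[≥] t) := by
  have hpos : ∀ m : ℕ, (0 : ℝ≥0) < (m : ℝ≥0) + 1 := fun m => by positivity
  have hle : ∀ m, t ≤ gridCeil m t := fun m => (le_div_iff₀ (hpos m)).2 (Nat.le_ceil _)
  refine tendsto_nhdsWithin_iff.2 ⟨?_, Eventually.of_forall hle⟩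
  refine tendsto_of_tendsto_of_tendsto_of_le_of_le (g := fun _ => t)
    (h := fun m : ℕ => t + 1 / ((m : ℝ≥0) + 1)) tendsto_const_nhds ?_ hle fun m => ?_
  · simpa using (tendsto_one_div_add_atTop_nhds_zero_nat (𝕜 := ℝ≥0)).const_add t
  · refine (div_le_iff₀ (hpos m)).2 ((Nat.ceil_lt_add_one zero_le).le.trans ?_)
    rw [add_mul, one_div, inv_mul_cancel₀ (hpos m).ne']

/-- A process with right-continuous paths is jointly measurable. -/
theorem measurable_uncurry_of_rightContinuous {Ω : Type*} {mΩ : MeasurableSpace Ω}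
    {u : ℝ≥0 → Ω → ℝ} (hu : ∀ t, Measurable (u t))
    (hc : ∀ ω t, ContinuousWithinAt (fun s => u s ω) (Set.Ici t) t) :
    Measurable (Function.uncurry u) := by
  refine measurable_of_tendsto_metrizable
    (f := fun (m : ℕ) (p : ℝ≥0 × Ω) => u (gridCeil m p.1) p.2) (fun m => ?_)
    (tendsto_pi_nhds.2 fun p => (hc p.2 p.1).tendsto.comp (tendsto_gridCeil p.1))
  have h1 : Measurable fun p : ℕ × Ω => u ((p.1 : ℝ≥0) / ((m : ℝ≥0) + 1)) p.2 :=
    measurable_from_prod_countable_right fun k => hu ((k : ℝ≥0) / ((m : ℝ≥0) + 1))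
  have h2 : Measurable fun p : ℝ≥0 × Ω => (⌈p.1 * ((m : ℝ≥0) + 1)⌉₊, p.2) :=
    (Nat.measurable_ceil.comp (measurable_fst.mul_const _)).prodMk measurable_snd
  exact h1.comp h2

/-! ### Paths of the chain -/

namespace IsMarkovChain

variable {Ω : Type*} {mΩ : MeasurableSpace Ω} {P : Measure Ω} {𝔽 : Filtration ℝ≥0 mΩ} {d : ℕ}
  {Q : Matrix (Fin d) (Fin d) ℝ} {X : ℝ≥0 → Ω → (Fin d → ℝ)}

theorem apply_eq_zero_or_one (h : IsMarkovChain P 𝔽 Q X) (t : ℝ≥0) (ω : Ω) (j : Fin d) :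
    X t ω j = 0 ∨ X t ω j = 1 := by
  obtain ⟨i, hi⟩ := h.basis_valued t ω
  rw [hi, Pi.single_apply]
  split_ifs <;> simp

theorem abs_apply_le_one (h : IsMarkovChain P 𝔽 Q X) (t : ℝ≥0) (ω : Ω) (j : Fin d) :
    |X t ω j| ≤ 1 := by
  rcases h.apply_eq_zero_or_one t ω j with h | h <;> simp [h]

theorem measurable_apply (h : IsMarkovChain P 𝔽 Q X) (t : ℝ≥0) (j : Fin d) :
    Measurable[𝔽 t] fun ω => X t ω j :=
  (measurable_pi_apply j).comp (h.adapted t).measurable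

theorem dotProduct_mul_apply (h : IsMarkovChain P 𝔽 Q X) (v : Fin d → ℝ) (t : ℝ≥0) (ω : Ω)
    (j : Fin d) : (v ⬝ᵥ X t ω) * X t ω j = v j * X t ω j := by
  obtain ⟨i, hi⟩ := h.basis_valued t ω
  rw [hi, dotProduct_single_one, Pi.single_apply]
  split_ifs with hij <;> simp [hij]

/-- The values of the chain form a finite set, so that a path is eventually constant along every filter
along which it converges. -/
theorem eventually_eq_of_tendsto (h : IsMarkovChain P 𝔽 Q X) {ω : Ω} {l : Filter ℝ≥0} [l.NeBot]
    {x : Fin d → ℝ} (hx : Tendsto (fun s => X s ω) l (𝓝 x)) : ∀ᶠ s in l, X s ω = x := by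
  let S : Set (Fin d → ℝ) := Set.range fun j => Pi.single j 1
  have hS : S.Finite := Set.finite_range _
  have hmem : ∀ s, X s ω ∈ S := fun s => by
    obtain ⟨j, hj⟩ := h.basis_valued s ω
    exact ⟨j, hj.symm⟩
  have hfin : (S \ {x}).Finite := hS.subset Set.sdiff_subset
  filter_upwards [hx (hfin.isClosed.isOpen_compl.mem_nhds (by simp))] with s hs
  by_contra hne
  exact hs ⟨hmem s, hne⟩

theorem eventually_nhdsGE_eq (h : IsMarkovChain P 𝔽 Q X) (ω : Ω) (t : ℝ≥0) :
    ∀ᶠ s in 𝓝[≥] t, X s ω = X t ω :=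
  h.eventually_eq_of_tendsto (h.right_continuous ω t).tendsto

end IsMarkovChain

/-! ### Estimates for the matrix exponential -/

section MatrixExp

attribute [local instance] Matrix.linftyOpNormedRing Matrix.linftyOpNormedAlgebra
  Matrix.linftyOpNormedAddCommGroup

variable {d : ℕ} (A : Matrix (Fin d) (Fin d) ℝ)

theorem exists_norm_exp_mulVec_sub_sub_le {ε : ℝ} (hε : 0 < ε) :
    ∃ δ > 0, ∀ h : ℝ, |h| ≤ δ → ∀ v : Fin d → ℝ,
      ‖NormedSpace.exp (h • A) *ᵥ v - v - h • (A *ᵥ v)‖ ≤ ε * |h| * ‖v‖ := by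
  have hd : HasDerivAt (fun h : ℝ => NormedSpace.exp (h • A)) A 0 := by
    have h := hasDerivAt_exp_smul_const A (0 : ℝ)
    rw [zero_smul, NormedSpace.exp_zero, one_mul] at h
    exact h
  have ho := (hasDerivAt_iff_isLittleO.1 hd).def hε
  obtain ⟨δ, hδ, hball⟩ := Metric.nhds_basis_closedBall.mem_iff.1 ho
  refine ⟨δ, hδ, fun h hh v => ?_⟩
  have h1 := hball (show h ∈ Metric.closedBall 0 δ by simpa using hh)
  simp only [Set.mem_ofPred_eq, sub_zero, zero_smul, NormedSpace.exp_zero, Real.norm_eq_abs] at h1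
  calc ‖NormedSpace.exp (h • A) *ᵥ v - v - h • (A *ᵥ v)‖
      = ‖(NormedSpace.exp (h • A) - 1 - h • A) *ᵥ v‖ := by
        rw [Matrix.sub_mulVec, Matrix.sub_mulVec, Matrix.one_mulVec, Matrix.smul_mulVec]
    _ ≤ ‖NormedSpace.exp (h • A) - 1 - h • A‖ * ‖v‖ := Matrix.linfty_opNorm_mulVec _ _
    _ ≤ _ := by gcongr

theorem exists_norm_exp_mulVec_sub_le :
    ∃ C ≥ 0, ∃ δ > 0, ∀ h : ℝ, |h| ≤ δ → ∀ v : Fin d → ℝ,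
      ‖NormedSpace.exp (h • A) *ᵥ v - v‖ ≤ C * |h| * ‖v‖ := by
  obtain ⟨δ, hδ, hA⟩ := exists_norm_exp_mulVec_sub_sub_le A one_pos
  refine ⟨1 + ‖A‖, by positivity, δ, hδ, fun h hh v => ?_⟩
  calc ‖NormedSpace.exp (h • A) *ᵥ v - v‖
      = ‖(NormedSpace.exp (h • A) *ᵥ v - v - h • (A *ᵥ v)) + h • (A *ᵥ v)‖ := by
        rw [sub_add_cancel]
    _ ≤ 1 * |h| * ‖v‖ + |h| * (‖A‖ * ‖v‖) := by
        refine (norm_add_le _ _).trans (add_le_add (hA h hh v) ?_)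
        rw [norm_smul, Real.norm_eq_abs]
        gcongr
        exact Matrix.linfty_opNorm_mulVec _ _
    _ = _ := by ring

theorem exists_norm_exp_mulVec_le (T : ℝ) :
    ∃ K ≥ 0, ∀ h ∈ Set.Icc 0 T, ∀ v : Fin d → ℝ,
      ‖NormedSpace.exp (h • A) *ᵥ v‖ ≤ K * ‖v‖ := by
  have hc : Continuous fun h : ℝ => NormedSpace.exp (h • A) :=
    continuous_iff_continuousAt.2 fun t => (hasDerivAt_exp_smul_const A t).continuousAt
  obtain ⟨K, hK⟩ := isCompact_Icc.exists_bound_of_continuousOn (s := Set.Icc 0 T) hc.continuousOn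
  refine ⟨max K 0, le_max_right _ _, fun h hh v => (Matrix.linfty_opNorm_mulVec _ _).trans ?_⟩
  gcongr
  exact (hK h hh).trans (le_max_left _ _)

theorem exp_add_smul_mulVec (a b : ℝ) (v : Fin d → ℝ) :
    NormedSpace.exp ((a + b) • A) *ᵥ v
      = NormedSpace.exp (a • A) *ᵥ (NormedSpace.exp (b • A) *ᵥ v) := by
  rw [add_smul, Matrix.exp_add_of_commute _ _ ((Commute.refl A).smul_left a |>.smul_right b),
    Matrix.mulVec_mulVec]

end MatrixExp

/-! ### Testing a conditional expectation against bounded variables -/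

section CondExp

variable {Ω : Type*} {m mΩ : MeasurableSpace Ω} {P : Measure Ω} [IsFiniteMeasure P]

theorem integral_mul_eq_of_condExp (hm : m ≤ mΩ) {G Y Z : Ω → ℝ} {K : ℝ} (hG : Measurable[m] G)
    (hK : ∀ ω, |G ω| ≤ K) (hY : Integrable Y P) (hZ : P[Y | m] =ᵐ[P] Z) :
    ∫ ω, G ω * Y ω ∂P = ∫ ω, G ω * Z ω ∂P := by
  have hGY : Integrable (G * Y) P :=
    hY.bdd_mul (c := K) (hG.mono hm le_rfl).aestronglyMeasurable (Eventually.of_forall hK)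
  have h := condExp_mul_of_stronglyMeasurable_left hG.stronglyMeasurable hGY hY
  calc ∫ ω, G ω * Y ω ∂P = ∫ ω, P[G * Y | m] ω ∂P := (integral_condExp hm).symm
    _ = ∫ ω, G ω * Z ω ∂P := by
      refine integral_congr_ae ?_
      filter_upwards [h, hZ] with ω h1 h2
      rw [h1, Pi.mul_apply, h2]

end CondExp

/-! ### The Markov property in mean -/

namespace IsMarkovChain

variable {Ω : Type*} {mΩ : MeasurableSpace Ω} {P : Measure Ω}
  {𝔽 : Filtration ℝ≥0 mΩ} {d : ℕ}
  {Q : Matrix (Fin d) (Fin d) ℝ} {X : ℝ≥0 → Ω → (Fin d → ℝ)}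

theorem measurable_apply' (h : IsMarkovChain P 𝔽 Q X) (t : ℝ≥0) (j : Fin d) :
    Measurable fun ω => X t ω j := (h.measurable_apply t j).mono (𝔽.le t) le_rfl

theorem abs_mul_apply_le (h : IsMarkovChain P 𝔽 Q X) (t : ℝ≥0) (ω : Ω) (j : Fin d) {x K : ℝ}
    (hx : |x| ≤ K) : |x * X t ω j| ≤ K := by
  rw [abs_mul]
  exact (mul_le_mul hx (h.abs_apply_le_one t ω j) (abs_nonneg _) ((abs_nonneg _).trans hx)).trans
    (mul_one K).le

variable [IsProbabilityMeasure P]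

theorem integrable_apply (h : IsMarkovChain P 𝔽 Q X) (t : ℝ≥0) (j : Fin d) :
    Integrable (fun ω => X t ω j) P :=
  .of_bound (h.measurable_apply' t j).aestronglyMeasurable 1
    (Eventually.of_forall fun ω => h.abs_apply_le_one t ω j)

theorem integrable_mul_apply (h : IsMarkovChain P 𝔽 Q X) (t : ℝ≥0) (j : Fin d) {G : Ω → ℝ} {K : ℝ}
    (hG : Measurable G) (hK : ∀ ω, |G ω| ≤ K) : Integrable (fun ω => G ω * X t ω j) P :=
  (h.integrable_apply t j).bdd_mul (c := K) hG.aestronglyMeasurable (Eventually.of_forall hK)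

theorem norm_integral_mul_apply_le (h : IsMarkovChain P 𝔽 Q X) (t : ℝ≥0) {G : Ω → ℝ} {K : ℝ}
    (hK0 : 0 ≤ K) (hK : ∀ ω, |G ω| ≤ K) :
    ‖fun j : Fin d => ∫ ω, G ω * X t ω j ∂P‖ ≤ K := by
  refine (pi_norm_le_iff_of_nonneg hK0).2 fun j => ?_
  simpa using norm_integral_le_of_norm_le_const (μ := P) (C := K)
    (f := fun ω => G ω * X t ω j)
    (Eventually.of_forall fun ω => h.abs_mul_apply_le t ω j (hK ω))

theorem integral_mul_apply (h : IsMarkovChain P 𝔽 Q X) {s t : ℝ≥0} (hst : s ≤ t) {G : Ω → ℝ} {K : ℝ}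
    (hG : Measurable[𝔽 s] G) (hK : ∀ ω, |G ω| ≤ K) :
    (fun j => ∫ ω, G ω * X t ω j ∂P)
      = NormedSpace.exp (((t : ℝ) - (s : ℝ)) • Q) *ᵥ fun j => ∫ ω, G ω * X s ω j ∂P := by
  have hX : Integrable (X t) P := Integrable.of_eval (h.integrable_apply t)
  funext j
  have h1 := (ContinuousLinearMap.proj (R := ℝ) (φ := fun _ : Fin d => ℝ) j).comp_condExp_comm
    (m := 𝔽 s) hX
  have h2 : P[fun ω => X t ω j | 𝔽 s]
      =ᵐ[P] fun ω => (NormedSpace.exp (((t : ℝ) - (s : ℝ)) • Q) *ᵥ X s ω) j := by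
    filter_upwards [h1, h.markov s t hst] with ω h3 h4
    rw [← h4]
    exact h3.symm
  rw [integral_mul_eq_of_condExp (𝔽.le s) hG hK (h.integrable_apply t j) h2]
  simp only [Matrix.mulVec, dotProduct, Finset.mul_sum]
  rw [integral_finsetSum _ fun i _ => ?_]
  · refine Finset.sum_congr rfl fun i _ => ?_
    rw [← integral_const_mul]
    exact integral_congr_ae (Eventually.of_forall fun ω => by ring)
  · exact ((h.integrable_mul_apply s i (hG.mono (𝔽.le s) le_rfl) hK).const_mul
      (NormedSpace.exp (((t : ℝ) - (s : ℝ)) • Q) j i)).congr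
      (Eventually.of_forall fun ω => by simp only []; ring)

/-- The chain is Lipschitz continuous in mean. -/
theorem exists_integral_abs_sub_le (h : IsMarkovChain P 𝔽 Q X) :
    ∃ C ≥ 0, ∃ δ > 0, ∀ s t : ℝ≥0, s ≤ t → (t : ℝ) - s ≤ δ → ∀ j,
      ∫ ω, |X t ω j - X s ω j| ∂P ≤ C * ((t : ℝ) - s) := by
  obtain ⟨C, hC, δ, hδ, hQ⟩ := exists_norm_exp_mulVec_sub_le Q
  refine ⟨C, hC, δ, hδ, fun s t hst hts j => ?_⟩
  have hst' : (0 : ℝ) ≤ (t : ℝ) - s := sub_nonneg.2 hst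
  -- For values in {0, 1}, |b - a| = (1 - 2a)(b - a). The sign 1 - 2a is known at time `s`, so the
  -- Markov property applies to the absolute increment.
  have hG : Measurable[𝔽 s] fun ω => 1 - 2 * X s ω j :=
    ((h.measurable_apply s j).const_mul 2).const_sub 1
  have hK : ∀ ω, |1 - 2 * X s ω j| ≤ 1 := fun ω => by
    rcases h.apply_eq_zero_or_one s ω j with h | h <;> norm_num [h]
  have h1 : ∀ ω, |X t ω j - X s ω j|
      = (1 - 2 * X s ω j) * X t ω j - (1 - 2 * X s ω j) * X s ω j := fun ω => by
    rcases h.apply_eq_zero_or_one s ω j with h1 | h1 <;>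
      rcases h.apply_eq_zero_or_one t ω j with h2 | h2 <;> norm_num [h1, h2]
  have hG' := hG.mono (𝔽.le s) le_rfl
  simp only [h1]
  rw [integral_sub (h.integrable_mul_apply t j hG' hK) (h.integrable_mul_apply s j hG' hK)]
  have h2 := congrFun (h.integral_mul_apply hst hG hK) j
  rw [h2]
  refine (le_abs_self _).trans ((norm_le_pi_norm (NormedSpace.exp (((t : ℝ) - (s : ℝ)) • Q) *ᵥ
    (fun j' => ∫ ω, (1 - 2 * X s ω j) * X s ω j' ∂P) -
    fun j' => ∫ ω, (1 - 2 * X s ω j) * X s ω j' ∂P) j).trans ?_)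
  refine (hQ _ (by rwa [abs_of_nonneg hst']) _).trans ?_
  rw [abs_of_nonneg hst']
  exact mul_le_of_le_one_right (by positivity) (h.norm_integral_mul_apply_le s zero_le_one hK)

end IsMarkovChain

/-- The default intensity `λᵀ X_s (n - N_s)`. -/
def defaultIntensity {Ω : Type*} {d n : ℕ} (lam : Fin d → ℝ) (X : ℝ≥0 → Ω → (Fin d → ℝ))
    (τ : Fin n → Ω → WithTop ℝ≥0) (s : ℝ) (ω : Ω) : ℝ :=
  (lam ⬝ᵥ X s.toNNReal ω) * ((n : ℝ) - (defaultCount τ s.toNNReal ω : ℝ))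

/-! ### The default intensity and the martingale property -/

namespace IsModel

variable {Ω : Type*} {mΩ : MeasurableSpace Ω} {P : Measure Ω} {𝔽 : Filtration ℝ≥0 mΩ} {d n : ℕ}
  {Q : Matrix (Fin d) (Fin d) ℝ} {lam : Fin d → ℝ} {X : ℝ≥0 → Ω → (Fin d → ℝ)}
  {τ : Fin n → Ω → WithTop ℝ≥0}

theorem measurable_count (hM : IsModel P 𝔽 Q lam X τ) (t : ℝ≥0) :
    Measurable fun ω => (defaultCount τ t ω : ℝ) :=
  measurable_from_top.comp ((measurable_defaultCount hM.stopping t).mono (𝔽.le t) le_rfl)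

theorem measurable_defaultIntensity (hM : IsModel P 𝔽 Q lam X τ) :
    Measurable (Function.uncurry (defaultIntensity lam X τ)) := by
  let u : ℝ≥0 → Ω → ℝ := fun s ω =>
    (lam ⬝ᵥ X s ω) * ((n : ℝ) - (defaultCount τ s ω : ℝ))
  have hu : Measurable (Function.uncurry u) := by
    refine measurable_uncurry_of_rightContinuous (fun t => ?_) fun ω t => ?_
    · refine Measurable.mul ?_ ((hM.measurable_count t).const_sub _)
      exact Finset.measurable_fun_sum _ fun j _ => (hM.chain.measurable_apply' t j).const_mul _
    · refine tendsto_const_nhds.congr' ?_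
      filter_upwards [hM.chain.eventually_nhdsGE_eq ω t, eventually_nhdsGE_defaultCount τ t ω]
        with s h1 h2
      simp only [u, h1, h2]
  exact hu.comp ((measurable_real_toNNReal.comp measurable_fst).prodMk measurable_snd)

theorem abs_dotProduct_le (hM : IsModel P 𝔽 Q lam X τ) (t : ℝ≥0) (ω : Ω) :
    |lam ⬝ᵥ X t ω| ≤ ∑ j, lam j := by
  refine (Finset.abs_sum_le_sum_abs _ _).trans (Finset.sum_le_sum fun j _ => ?_)
  exact hM.chain.abs_mul_apply_le t ω j (abs_of_nonneg (hM.rate_nonneg j)).le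

theorem sum_rate_nonneg (hM : IsModel P 𝔽 Q lam X τ) : 0 ≤ ∑ j, lam j :=
  Finset.sum_nonneg fun j _ => hM.rate_nonneg j

theorem abs_defaultIntensity_le (hM : IsModel P 𝔽 Q lam X τ) (s : ℝ) (ω : Ω) :
    |defaultIntensity lam X τ s ω| ≤ (∑ j, lam j) * n := by
  rw [defaultIntensity, abs_mul]
  have h1 : (defaultCount τ s.toNNReal ω : ℝ) ≤ n := by exact_mod_cast defaultCount_le τ _ ω
  have h2 : (0 : ℝ) ≤ defaultCount τ s.toNNReal ω := Nat.cast_nonneg _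
  refine mul_le_mul (hM.abs_dotProduct_le _ ω) ?_ (abs_nonneg _) hM.sum_rate_nonneg
  rw [abs_of_nonneg (sub_nonneg.2 h1)]
  linarith

theorem intervalIntegrable_defaultIntensity (hM : IsModel P 𝔽 Q lam X τ) (ω : Ω) (a b : ℝ) :
    IntervalIntegrable (fun s => defaultIntensity lam X τ s ω) volume a b :=
  intervalIntegrable_const.mono_fun' (g := fun _ => (∑ j, lam j) * n)
    (hM.measurable_defaultIntensity.comp measurable_prodMk_right).aestronglyMeasurable
    (Eventually.of_forall fun s => hM.abs_defaultIntensity_le s ω)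

variable [IsProbabilityMeasure P]

theorem integrable_count (hM : IsModel P 𝔽 Q lam X τ) (t : ℝ≥0) :
    Integrable (fun ω => (defaultCount τ t ω : ℝ)) P :=
  .of_bound (hM.measurable_count t).aestronglyMeasurable n (Eventually.of_forall fun ω => by
    simpa using defaultCount_le τ t ω)

theorem integrable_defaultIntensity (hM : IsModel P 𝔽 Q lam X τ) (s : ℝ) :
    Integrable (defaultIntensity lam X τ s) P :=
  .of_bound (hM.measurable_defaultIntensity.comp measurable_prodMk_left).aestronglyMeasurable _
    (Eventually.of_forall (hM.abs_defaultIntensity_le s))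

theorem integrable_mul_defaultIntensity (hM : IsModel P 𝔽 Q lam X τ) (a b : ℝ) {G : Ω → ℝ} {K : ℝ}
    (hG : Measurable G) (hK : ∀ ω, |G ω| ≤ K) :
    Integrable (Function.uncurry fun s ω => G ω * defaultIntensity lam X τ s ω)
      ((volume.restrict (Set.uIoc a b)).prod P) := by
  have : IsFiniteMeasure (volume.restrict (Set.uIoc a b)) := by
    unfold Set.uIoc
    infer_instance
  refine .of_bound ((hG.comp measurable_snd).mul
    hM.measurable_defaultIntensity).aestronglyMeasurable (K * ((∑ j, lam j) * n))
    (Eventually.of_forall fun p => ?_)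
  rw [Function.uncurry, norm_mul]
  exact mul_le_mul (hK _) (hM.abs_defaultIntensity_le _ _) (norm_nonneg _)
    ((abs_nonneg _).trans (hK p.2))

/-- The martingale property of the compensated number of defaults, tested against a bounded
variable known at the earlier time. -/
theorem integral_mul_count_sub (hM : IsModel P 𝔽 Q lam X τ) {s t : ℝ≥0} (hst : s ≤ t) {G : Ω → ℝ}
    {K : ℝ} (hG : Measurable[𝔽 s] G) (hK : ∀ ω, |G ω| ≤ K) :
    ∫ ω, G ω * ((defaultCount τ t ω : ℝ) - defaultCount τ s ω) ∂P
      = ∫ r in (s : ℝ)..t, ∫ ω, G ω * defaultIntensity lam X τ r ω ∂P := by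
  have hG' := hG.mono (𝔽.le s) le_rfl
  rw [intervalIntegral_integral_swap (hM.integrable_mul_defaultIntensity _ _ hG' hK)]
  have hm : ∀ t, Integrable (fun ω => G ω * compensatedCount lam X τ t ω) P := fun t =>
    (hM.martingale.integrable t).bdd_mul (c := K) hG'.aestronglyMeasurable (Eventually.of_forall hK)
  have h0 := integral_mul_eq_of_condExp (𝔽.le s) hG hK (hM.martingale.integrable t)
    (hM.martingale.2 s t hst)
  -- Adding this zero to the right-hand side turns the claim into an identity that holds for every
  -- ω.
  have h1 : ∫ ω, (G ω * compensatedCount lam X τ t ω - G ω * compensatedCount lam X τ s ω) ∂P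
      = 0 := by
    rw [integral_sub (hm t) (hm s), h0, sub_self]
  have h2 : Integrable (fun ω => ∫ r in (s : ℝ)..t, G ω * defaultIntensity lam X τ r ω) P := by
    have := (hM.integrable_mul_defaultIntensity s t hG' hK).integral_prod_right
    refine this.congr (Eventually.of_forall fun ω => ?_)
    beta_reduce
    rw [intervalIntegral.integral_of_le (by exact_mod_cast hst),
      Set.uIoc_of_le (by exact_mod_cast hst)]
    rfl
  rw [← zero_add (∫ ω, (∫ r in (s : ℝ)..t, G ω * defaultIntensity lam X τ r ω) ∂P), ← h1,
    ← integral_add (f := fun ω => G ω * compensatedCount lam X τ t ω - G ω * compensatedCount lam X τ s ω) ((hm t).sub (hm s)) h2]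
  refine integral_congr_ae (Eventually.of_forall fun ω => ?_)
  have h3 := intervalIntegral.integral_interval_sub_left
    (hM.intervalIntegrable_defaultIntensity ω 0 t) (hM.intervalIntegrable_defaultIntensity ω 0 s)
  have h4 : ∀ t : ℝ≥0, compensatedCount lam X τ t ω
      = (defaultCount τ t ω : ℝ) - ∫ s in (0 : ℝ)..(t : ℝ), defaultIntensity lam X τ s ω :=
    fun _ => rfl
  simp only [intervalIntegral.integral_const_mul, h4, ← h3]
  ring

theorem integral_count_sub_le (hM : IsModel P 𝔽 Q lam X τ) {s t : ℝ≥0} (hst : s ≤ t) :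
    ∫ ω, |(defaultCount τ t ω : ℝ) - defaultCount τ s ω| ∂P
      ≤ (∑ j, lam j) * n * ((t : ℝ) - s) := by
  have h1 := hM.integral_mul_count_sub hst (G := fun _ => 1) (K := 1) measurable_const (by simp)
  have h2 : ∀ ω, |(defaultCount τ t ω : ℝ) - defaultCount τ s ω|
      = 1 * ((defaultCount τ t ω : ℝ) - defaultCount τ s ω) := fun ω => by
    rw [one_mul, abs_of_nonneg (sub_nonneg.2 (by exact_mod_cast defaultCount_mono τ hst ω))]
  simp only [h2, h1]
  have h3 := intervalIntegral.norm_integral_le_of_norm_le_const (a := (s : ℝ)) (b := t)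
    (f := fun r => ∫ ω, 1 * defaultIntensity lam X τ r ω ∂P) (C := (∑ j, lam j) * n) fun r _ => by
      simpa using norm_integral_le_of_norm_le_const (μ := P)
        (f := fun ω => 1 * defaultIntensity lam X τ r ω)
        (Eventually.of_forall fun ω => by
          simpa using hM.abs_defaultIntensity_le r ω)
  rw [abs_of_nonneg (sub_nonneg.2 (by exact_mod_cast hst))] at h3
  exact (le_abs_self _).trans h3

/-- The default intensity is Lipschitz continuous in mean. -/
theorem exists_integral_abs_defaultIntensity_sub_le (hM : IsModel P 𝔽 Q lam X τ) :
    ∃ C ≥ 0, ∃ δ > 0, ∀ s t : ℝ≥0, s ≤ t → (t : ℝ) - s ≤ δ →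
      ∫ ω, |defaultIntensity lam X τ t ω - defaultIntensity lam X τ s ω| ∂P
        ≤ C * ((t : ℝ) - s) := by
  obtain ⟨C, hC, δ, hδ, hX⟩ := hM.chain.exists_integral_abs_sub_le
  set L := ∑ j, lam j with hL
  have hL0 : 0 ≤ L := hM.sum_rate_nonneg
  refine ⟨n * L * C + L * (L * n), by positivity, δ, hδ, fun s t hst hts => ?_⟩
  have hXi : ∀ j, Integrable (fun ω => |X t ω j - X s ω j|) P := fun j =>
    ((hM.chain.integrable_apply t j).sub (hM.chain.integrable_apply s j)).abs
  have hXs : Integrable (fun ω => ∑ j, lam j * |X t ω j - X s ω j|) P :=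
    integrable_finsetSum _ fun j _ => (hXi j).const_mul _
  have hNi : Integrable (fun ω => |(defaultCount τ t ω : ℝ) - defaultCount τ s ω|) P :=
    ((hM.integrable_count t).sub (hM.integrable_count s)).abs
  have hpt : ∀ ω, |defaultIntensity lam X τ t ω - defaultIntensity lam X τ s ω|
      ≤ n * ∑ j, lam j * |X t ω j - X s ω j|
        + L * |(defaultCount τ t ω : ℝ) - defaultCount τ s ω| := fun ω => by
    have h1 : (defaultCount τ t ω : ℝ) ≤ n := by exact_mod_cast defaultCount_le τ _ ω
    have h2 : (0 : ℝ) ≤ defaultCount τ t ω := Nat.cast_nonneg _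
    have h3 : defaultIntensity lam X τ t ω - defaultIntensity lam X τ s ω
        = ((n : ℝ) - defaultCount τ t ω) * (lam ⬝ᵥ (X t ω - X s ω))
          - (lam ⬝ᵥ X s ω) * ((defaultCount τ t ω : ℝ) - defaultCount τ s ω) := by
      simp only [defaultIntensity, Real.toNNReal_coe, dotProduct_sub]
      ring
    rw [h3]
    refine (abs_sub _ _).trans (add_le_add ?_ ?_)
    · rw [abs_mul, abs_of_nonneg (sub_nonneg.2 h1)]
      refine mul_le_mul (by linarith) ?_ (abs_nonneg _) (Nat.cast_nonneg _)
      refine (Finset.abs_sum_le_sum_abs _ _).trans (Finset.sum_le_sum fun j _ => ?_)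
      rw [abs_mul, abs_of_nonneg (hM.rate_nonneg j), Pi.sub_apply]
    · rw [abs_mul]
      exact mul_le_mul_of_nonneg_right (hM.abs_dotProduct_le s ω) (abs_nonneg _)
  calc ∫ ω, |defaultIntensity lam X τ t ω - defaultIntensity lam X τ s ω| ∂P
      ≤ ∫ ω, (n * ∑ j, lam j * |X t ω j - X s ω j|
        + L * |(defaultCount τ t ω : ℝ) - defaultCount τ s ω|) ∂P :=
        integral_mono ((hM.integrable_defaultIntensity t).sub
          (hM.integrable_defaultIntensity s)).abs ((hXs.const_mul _).add (hNi.const_mul _)) hpt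
    _ = n * ∑ j, lam j * ∫ ω, |X t ω j - X s ω j| ∂P
        + L * ∫ ω, |(defaultCount τ t ω : ℝ) - defaultCount τ s ω| ∂P := by
        rw [integral_add (hXs.const_mul _) (hNi.const_mul _), integral_const_mul,
          integral_const_mul, integral_finsetSum _ fun j _ => (hXi j).const_mul _]
        simp only [integral_const_mul]
    _ ≤ n * ∑ j, lam j * (C * ((t : ℝ) - s)) + L * (L * n * ((t : ℝ) - s)) := by
        gcongr with j
        · exact hM.rate_nonneg j
        · exact hX s t hst hts j
        · exact hM.integral_count_sub_le hst
    _ = _ := by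
        rw [← Finset.sum_mul, ← hL]
        ring

/-- The intensity moves by O(t - s) in mean over [s, t], so freezing it at time `s` under the time
integral costs O((t - s)²). The constants do not depend on `G`. -/
theorem exists_abs_integral_mul_count_sub_le (hM : IsModel P 𝔽 Q lam X τ) :
    ∃ C ≥ 0, ∃ δ > 0, ∀ s t : ℝ≥0, s ≤ t → (t : ℝ) - s ≤ δ → ∀ (G : Ω → ℝ) (K : ℝ),
      Measurable[𝔽 s] G → (∀ ω, |G ω| ≤ K) →
      |∫ ω, G ω * ((defaultCount τ t ω : ℝ) - defaultCount τ s ω) ∂P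
        - ((t : ℝ) - s) * ∫ ω, G ω * defaultIntensity lam X τ s ω ∂P|
        ≤ K * C * ((t : ℝ) - s) ^ 2 := by
  obtain ⟨C, hC, δ, hδ, hA⟩ := hM.exists_integral_abs_defaultIntensity_sub_le
  refine ⟨C, hC, δ, hδ, fun s t hst hts G K hG hK => ?_⟩
  have hst' : (s : ℝ) ≤ t := by exact_mod_cast hst
  have hG' := hG.mono (𝔽.le s) le_rfl
  have hi : ∀ r, Integrable (fun ω => G ω * defaultIntensity lam X τ r ω) P := fun r =>
    (hM.integrable_defaultIntensity r).bdd_mul (c := K) hG'.aestronglyMeasurable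
      (Eventually.of_forall hK)
  have hii : IntervalIntegrable (fun r => ∫ ω, G ω * defaultIntensity lam X τ r ω ∂P)
      volume s t := by
    rw [intervalIntegrable_iff]
    exact (hM.integrable_mul_defaultIntensity s t hG' hK).integral_prod_left
  have h1 : ∫ ω, G ω * ((defaultCount τ t ω : ℝ) - defaultCount τ s ω) ∂P
        - ((t : ℝ) - s) * ∫ ω, G ω * defaultIntensity lam X τ s ω ∂P
      = ∫ r in (s : ℝ)..t, ((∫ ω, G ω * defaultIntensity lam X τ r ω ∂P)
        - ∫ ω, G ω * defaultIntensity lam X τ s ω ∂P) := by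
    rw [hM.integral_mul_count_sub hst hG hK, intervalIntegral.integral_sub hii (by simp),
      intervalIntegral.integral_const, smul_eq_mul]
  rw [h1]
  have h2 := intervalIntegral.norm_integral_le_of_norm_le_const (a := (s : ℝ)) (b := t)
    (f := fun r => (∫ ω, G ω * defaultIntensity lam X τ r ω ∂P)
        - ∫ ω, G ω * defaultIntensity lam X τ s ω ∂P) (C := K * (C * ((t : ℝ) - s))) fun r hr => ?_
  · rw [abs_of_nonneg (sub_nonneg.2 hst')] at h2
    exact h2.trans (by ring_nf; rfl)
  · rw [Set.uIoc_of_le hst'] at hr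
    obtain ⟨r, rfl⟩ : ∃ r' : ℝ≥0, (r' : ℝ) = r := ⟨⟨r, s.2.trans hr.1.le⟩, rfl⟩
    have hsr : s ≤ r := by exact_mod_cast hr.1.le
    have hd : Integrable (fun ω => |defaultIntensity lam X τ r ω - defaultIntensity lam X τ s ω|) P :=
      ((hM.integrable_defaultIntensity r).sub (hM.integrable_defaultIntensity s)).abs
    obtain ⟨ω₀⟩ : Nonempty Ω := P.nonempty_of_neZero
    have hK0 : 0 ≤ K := (abs_nonneg _).trans (hK ω₀)
    rw [← integral_sub (hi r) (hi s)]
    calc ‖∫ ω, (G ω * defaultIntensity lam X τ r ω - G ω * defaultIntensity lam X τ s ω) ∂P‖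
        ≤ ∫ ω, K * |defaultIntensity lam X τ r ω - defaultIntensity lam X τ s ω| ∂P := by
          refine norm_integral_le_of_norm_le (hd.const_mul K) (Eventually.of_forall fun ω => ?_)
          rw [← mul_sub, Real.norm_eq_abs, abs_mul]
          exact mul_le_mul_of_nonneg_right (hK ω) (abs_nonneg _)
      _ = K * ∫ ω, |defaultIntensity lam X τ r ω - defaultIntensity lam X τ s ω| ∂P :=
          integral_const_mul _ _
      _ ≤ K * (C * ((r : ℝ) - s)) := by
          gcongr
          exact hA s r hsr (by linarith [hr.2])
      _ ≤ _ := by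
          gcongr
          exact hr.2

end IsModel

/-- The remainder in the first-order expansion of the increment of `g(N) X` over `[s, t]`. -/
def incrementRemainder {Ω : Type*} {d n : ℕ} (g : ℕ → ℝ) (X : ℝ≥0 → Ω → (Fin d → ℝ))
    (τ : Fin n → Ω → WithTop ℝ≥0) (j : Fin d) (s t : ℝ≥0) (ω : Ω) : ℝ :=
  (g (defaultCount τ t ω) - g (defaultCount τ s ω)) * X t ω j -
    (g (defaultCount τ s ω + 1) - g (defaultCount τ s ω)) * X s ω j *
      ((defaultCount τ t ω : ℝ) - defaultCount τ s ω)

/-- The points of the grid that divides `[0, T]` into `m + 1` intervals. -/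
def grid (T : ℝ≥0) (m i : ℕ) : ℝ≥0 := i * (T / (m + 1))

theorem grid_mono (T : ℝ≥0) (m : ℕ) : Monotone (grid T m) := fun i j hij => by
  unfold grid
  gcongr

@[simp]
theorem grid_zero (T : ℝ≥0) (m : ℕ) : grid T m 0 = 0 := by simp [grid]

@[simp]
theorem grid_last (T : ℝ≥0) (m : ℕ) : grid T m (m + 1) = T := by
  have h : ((m : ℝ≥0) + 1) ≠ 0 := by positivity
  rw [grid]
  push_cast
  field_simp

theorem grid_succ_sub (T : ℝ≥0) (m i : ℕ) :
    (grid T m (i + 1) : ℝ) - grid T m i = T / (m + 1) := by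
  simp only [grid]
  push_cast
  ring

theorem grid_le {m i : ℕ} (T : ℝ≥0) (hi : i ≤ m + 1) : grid T m i ≤ T :=
  (grid_mono T m hi).trans (grid_last T m).le

theorem tendsto_mesh (T : ℝ≥0) :
    Tendsto (fun m : ℕ => (T : ℝ) / (m + 1)) atTop (𝓝 0) := by
  simpa [div_eq_mul_inv] using
    (tendsto_one_div_add_atTop_nhds_zero_nat (𝕜 := ℝ)).const_mul (T : ℝ)

/-- Distinct integers differ by at least 1, so boundedness already gives a Lipschitz bound. -/
theorem abs_sub_le_two_mul_mul_sub {g : ℕ → ℝ} {K : ℝ} (hg : ∀ N, |g N| ≤ K) {a b : ℕ} (hab : a ≤ b) :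
    |g b - g a| ≤ 2 * K * ((b : ℝ) - a) := by
  have hK : 0 ≤ K := (abs_nonneg _).trans (hg 0)
  rcases hab.eq_or_lt with rfl | h
  · simp
  · have h1 : (1 : ℝ) ≤ (b : ℝ) - a := by
      have : (a : ℝ) + 1 ≤ b := by exact_mod_cast h
      linarith
    calc |g b - g a| ≤ |g b| + |g a| := abs_sub _ _
      _ ≤ 2 * K * 1 := by linarith [hg a, hg b]
      _ ≤ _ := by gcongr

/-! ### The remainder vanishes in the limit of fine grids -/

namespace IsModel

variable {Ω : Type*} {mΩ : MeasurableSpace Ω} {P : Measure Ω} {𝔽 : Filtration ℝ≥0 mΩ} {d n : ℕ}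
  {Q : Matrix (Fin d) (Fin d) ℝ} {lam : Fin d → ℝ} {X : ℝ≥0 → Ω → (Fin d → ℝ)}
  {τ : Fin n → Ω → WithTop ℝ≥0} {g : ℕ → ℝ}

/-- Where X is continuous it is locally constant, and N moves by 0 or 1, for which the expansion in
N_t - N_s is exact. Where N is continuous it is locally constant and both terms vanish. -/
theorem exists_nhds_incrementRemainder_eq_zero (hM : IsModel P 𝔽 Q lam X τ) {ω : Ω}
    (hω : ∀ i j, i ≠ j → τ i ω = τ j ω → τ i ω = ⊤) {x : ℝ≥0}
    (hx : ContinuousAt (fun s => X s ω) x ∨ ContinuousAt (fun s => defaultCount τ s ω) x)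
    (g : ℕ → ℝ) (j : Fin d) :
    ∃ U ∈ 𝓝 x, ∀ s ∈ U, ∀ t ∈ U, s ≤ t → incrementRemainder g X τ j s t ω = 0 := by
  rcases hx with hx | hx
  · have h1 : ∀ᶠ s in 𝓝 x, X s ω = X x ω := hM.chain.eventually_eq_of_tendsto hx
    have h2 := eventually_nhdsWithin_iff.1 (eventually_nhdsGE_defaultCount τ x ω)
    have h3 := eventually_nhdsWithin_iff.1 (eventually_nhdsLT_defaultCount τ x ω)
    refine ⟨_, h1.and (h2.and h3), fun s ⟨hs1, hs2, hs3⟩ t ⟨ht1, ht2, ht3⟩ hst => ?_⟩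
    have hle := defaultCount_le_defaultCountLeft_add_one τ hω x
    have hmono := defaultCount_mono τ hst ω
    have hstep : defaultCount τ t ω = defaultCount τ s ω
        ∨ defaultCount τ t ω = defaultCount τ s ω + 1 := by
      rcases le_or_gt x s with h | h
      · exact Or.inl ((ht2 (h.trans hst)).trans (hs2 h).symm)
      · rcases le_or_gt x t with h' | h'
        · have := hs3 h
          have := ht2 h'
          omega
        · exact Or.inl ((ht3 h').trans (hs3 h).symm)
    rw [incrementRemainder, ht1, hs1]
    rcases hstep with h | h
    · simp [h]
    · rw [h]
      push_cast
      ring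
  · have h1 : ∀ᶠ s in 𝓝 x, defaultCount τ s ω = defaultCount τ x ω := by
      have : Tendsto (fun s => defaultCount τ s ω) (𝓝 x) (pure (defaultCount τ x ω)) := by
        rw [← nhds_discrete]
        exact hx
      exact tendsto_pure.1 this
    refine ⟨_, h1, fun s hs t ht _ => ?_⟩
    rw [Set.mem_ofPred_eq] at hs ht
    simp [incrementRemainder, hs, ht]

/-- Compactness of [0, T] and the Lebesgue number lemma make the local statement uniform in time.
The mesh `δ` depends on `ω`, which dominated convergence tolerates. -/
theorem exists_incrementRemainder_eq_zero (hM : IsModel P 𝔽 Q lam X τ) {ω : Ω}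
    (hω : ∀ i j, i ≠ j → τ i ω = τ j ω → τ i ω = ⊤)
    (hx : ∀ x, ContinuousAt (fun s => X s ω) x ∨ ContinuousAt (fun s => defaultCount τ s ω) x)
    (g : ℕ → ℝ) (j : Fin d) (T : ℝ≥0) :
    ∃ δ > 0, ∀ s t : ℝ≥0, s ≤ t → s ≤ T → (t : ℝ) - s < δ →
      incrementRemainder g X τ j s t ω = 0 := by
  choose U hU hU0 using fun x => hM.exists_nhds_incrementRemainder_eq_zero hω (hx x) g j
  obtain ⟨V, hV, hVU⟩ := lebesgue_number_lemma_nhds (isCompact_Icc (a := (0 : ℝ≥0)) (b := T))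
    fun x _ => hU x
  obtain ⟨δ, hδ, hδV⟩ := Metric.mem_uniformity_dist.1 hV
  refine ⟨δ, hδ, fun s t hst hsT hts => ?_⟩
  obtain ⟨y, hy⟩ := hVU s ⟨zero_le, hsT⟩
  refine hU0 y s (hy (hδV (by simpa using hδ))) t (hy (hδV ?_)) hst
  rwa [NNReal.dist_eq, abs_sub_comm, abs_of_nonneg (sub_nonneg.2 (by exact_mod_cast hst))]

theorem abs_incrementRemainder_le (hM : IsModel P 𝔽 Q lam X τ) {K : ℝ} (hg : ∀ N, |g N| ≤ K)
    (j : Fin d) {s t : ℝ≥0} (hst : s ≤ t) (ω : Ω) :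
    |incrementRemainder g X τ j s t ω|
      ≤ 4 * K * ((defaultCount τ t ω : ℝ) - defaultCount τ s ω) := by
  have h0 := defaultCount_mono τ hst ω
  have h0' : (0 : ℝ) ≤ (defaultCount τ t ω : ℝ) - defaultCount τ s ω :=
    sub_nonneg.2 (by exact_mod_cast h0)
  have h1 := hM.chain.abs_mul_apply_le t ω j (abs_sub_le_two_mul_mul_sub hg h0)
  have h2 := hM.chain.abs_mul_apply_le s ω j
    (abs_sub_le_two_mul_mul_sub hg (Nat.le_succ (defaultCount τ s ω)))
  rw [Nat.cast_succ, add_sub_cancel_left, mul_one] at h2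
  rw [incrementRemainder]
  refine (abs_sub _ _).trans ?_
  rw [abs_mul (_ * _) (_ - _), abs_of_nonneg h0']
  calc _ ≤ 2 * K * ((defaultCount τ t ω : ℝ) - defaultCount τ s ω)
        + 2 * K * ((defaultCount τ t ω : ℝ) - defaultCount τ s ω) :=
        add_le_add h1 (mul_le_mul_of_nonneg_right h2 h0')
    _ = _ := by ring

theorem measurable_comp_count (hM : IsModel P 𝔽 Q lam X τ) (g : ℕ → ℝ) (t : ℝ≥0) :
    Measurable[𝔽 t] fun ω => g (defaultCount τ t ω) :=
  measurable_from_top.comp (measurable_defaultCount hM.stopping t)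

theorem measurable_incrementRemainder (hM : IsModel P 𝔽 Q lam X τ) (g : ℕ → ℝ) (j : Fin d)
    (s t : ℝ≥0) : Measurable (incrementRemainder g X τ j s t) := by
  have hg : ∀ (g : ℕ → ℝ) t, Measurable fun ω => g (defaultCount τ t ω) := fun g t =>
    (hM.measurable_comp_count g t).mono (𝔽.le t) le_rfl
  have hX := fun t => hM.chain.measurable_apply' t j
  exact (((hg g t).sub (hg g s)).mul (hX t)).sub
    ((((hg (fun N => g (N + 1)) s).sub (hg g s)).mul (hX s)).mul
      ((hM.measurable_count t).sub (hM.measurable_count s)))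

theorem sum_abs_incrementRemainder_le (hM : IsModel P 𝔽 Q lam X τ) {K : ℝ} (hg : ∀ N, |g N| ≤ K)
    (j : Fin d) (T : ℝ≥0) (m : ℕ) (ω : Ω) :
    ∑ i ∈ Finset.range (m + 1),
      |incrementRemainder g X τ j (grid T m i) (grid T m (i + 1)) ω| ≤ 4 * K * n := by
  have hK : 0 ≤ K := (abs_nonneg _).trans (hg 0)
  refine (Finset.sum_le_sum fun i _ => hM.abs_incrementRemainder_le hg j
    (grid_mono T m (Nat.le_succ i)) ω).trans ?_
  rw [← Finset.mul_sum,
    Finset.sum_range_sub (fun i => (defaultCount τ (grid T m i) ω : ℝ)) (m + 1)]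
  have h1 : (defaultCount τ (grid T m (m + 1)) ω : ℝ) ≤ n := by
    exact_mod_cast defaultCount_le τ _ ω
  have h2 : (0 : ℝ) ≤ defaultCount τ (grid T m 0) ω := Nat.cast_nonneg _
  gcongr
  linarith

variable [IsProbabilityMeasure P]

theorem integrable_incrementRemainder (hM : IsModel P 𝔽 Q lam X τ) {K : ℝ} (hg : ∀ N, |g N| ≤ K)
    (j : Fin d) {s t : ℝ≥0} (hst : s ≤ t) : Integrable (incrementRemainder g X τ j s t) P :=
  (((hM.integrable_count t).sub (hM.integrable_count s)).const_mul (4 * K)).mono'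
    (hM.measurable_incrementRemainder g j s t).aestronglyMeasurable
    (Eventually.of_forall (hM.abs_incrementRemainder_le hg j hst))

theorem tendsto_sum_integral_abs_incrementRemainder (hM : IsModel P 𝔽 Q lam X τ) {K : ℝ}
    (hg : ∀ N, |g N| ≤ K) (j : Fin d) (T : ℝ≥0) :
    Tendsto (fun m => ∑ i ∈ Finset.range (m + 1),
      ∫ ω, |incrementRemainder g X τ j (grid T m i) (grid T m (i + 1)) ω| ∂P) atTop (𝓝 0) := by
  have h1 : ∀ m, ∑ i ∈ Finset.range (m + 1),
      ∫ ω, |incrementRemainder g X τ j (grid T m i) (grid T m (i + 1)) ω| ∂P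
      = ∫ ω, ∑ i ∈ Finset.range (m + 1),
        |incrementRemainder g X τ j (grid T m i) (grid T m (i + 1)) ω| ∂P := fun m =>
    (integral_finsetSum _ fun i _ =>
      (hM.integrable_incrementRemainder hg j (grid_mono T m (Nat.le_succ i))).abs).symm
  simp only [h1]
  rw [← integral_zero Ω ℝ (μ := P)]
  refine tendsto_integral_of_dominated_convergence (fun _ => 4 * K * n) (fun m => ?_)
    (integrable_const _) (fun m => Eventually.of_forall fun ω => ?_) ?_
  · exact (Finset.measurable_fun_sum _ fun i _ =>
      (hM.measurable_incrementRemainder g j _ _).abs).aestronglyMeasurable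
  · rw [Real.norm_eq_abs, abs_of_nonneg (Finset.sum_nonneg fun i _ => abs_nonneg _)]
    exact hM.sum_abs_incrementRemainder_le hg j T m ω
  · filter_upwards [hM.no_simultaneous_defaults, hM.no_common_jumps] with ω hω hx
    obtain ⟨δ, hδ, hzero⟩ := hM.exists_incrementRemainder_eq_zero hω hx g j T
    refine tendsto_const_nhds.congr' ?_
    filter_upwards [(tendsto_mesh T).eventually (Iio_mem_nhds hδ)] with m hm
    refine (Finset.sum_eq_zero fun i hi => ?_).symm
    rw [hzero _ _ (grid_mono T m (Nat.le_succ i)) (grid_le T (Finset.mem_range.1 hi).le)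
      (by rw [grid_succ_sub]; exact hm), abs_zero]

end IsModel

/-- The vector `𝔼 [g(N_t) X_t]`. -/
def countMoment {Ω : Type*} {mΩ : MeasurableSpace Ω} (P : Measure Ω) {d n : ℕ} (g : ℕ → ℝ)
    (X : ℝ≥0 → Ω → (Fin d → ℝ)) (τ : Fin n → Ω → WithTop ℝ≥0) (t : ℝ≥0) : Fin d → ℝ :=
  fun j => ∫ ω, g (defaultCount τ t ω) * X t ω j ∂P

/-! ### The closed linear equation for the moments -/

namespace IsModel

variable {Ω : Type*} {mΩ : MeasurableSpace Ω} {P : Measure Ω} {𝔽 : Filtration ℝ≥0 mΩ} {d n : ℕ}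
  {Q : Matrix (Fin d) (Fin d) ℝ} {lam : Fin d → ℝ} {X : ℝ≥0 → Ω → (Fin d → ℝ)}
  {τ : Fin n → Ω → WithTop ℝ≥0} {g : ℕ → ℝ} [IsProbabilityMeasure P]

theorem integrable_comp_count_mul_apply (hM : IsModel P 𝔽 Q lam X τ) {K : ℝ}
    (hg : ∀ N, |g N| ≤ K) (s t : ℝ≥0) (j : Fin d) :
    Integrable (fun ω => g (defaultCount τ s ω) * X t ω j) P :=
  hM.chain.integrable_mul_apply t j ((hM.measurable_comp_count g s).mono (𝔽.le s) le_rfl)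
    fun _ => hg _

/-- First-order expansion of the increments of `𝔼 [g(N_t) X_t]`. -/
theorem exists_abs_countMoment_sub_le (hM : IsModel P 𝔽 Q lam X τ) {K : ℝ}
    (hg : ∀ N, |g N| ≤ K) {k : ℕ}
    (hgk : ∀ N ≤ n, (g (N + 1) - g N) * ((n : ℝ) - N) = -(k * g N)) {ε : ℝ} (hε : 0 < ε) :
    ∃ δ > 0, ∀ s t : ℝ≥0, s ≤ t → (t : ℝ) - s ≤ δ → ∀ j,
      |countMoment P g X τ t j
        - (NormedSpace.exp (((t : ℝ) - s) • Qmod Q lam k) *ᵥ countMoment P g X τ s) j|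
        ≤ ε * ((t : ℝ) - s) + ∫ ω, |incrementRemainder g X τ j s t ω| ∂P := by
  have hK : 0 ≤ K := (abs_nonneg _).trans (hg 0)
  -- Three errors of size `η * h * K` occur: one from each exponential and one from freezing the
  -- intensity. The +1 covers `K = 0`.
  obtain ⟨η, hη, hηK⟩ : ∃ η > 0, 3 * η * (K + 1) ≤ ε :=
    ⟨ε / (3 * (K + 1)), by positivity, le_of_eq (by field_simp)⟩
  obtain ⟨δ₁, hδ₁, hQ⟩ := exists_norm_exp_mulVec_sub_sub_le Q hη
  obtain ⟨δ₂, hδ₂, hB⟩ := exists_norm_exp_mulVec_sub_sub_le (Qmod Q lam k) hη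
  obtain ⟨C, hC, δ₃, hδ₃, hN⟩ := hM.exists_abs_integral_mul_count_sub_le
  -- Below this step length the quadratic error `2 * K * C * h ^ 2` is at most `η * h * K`.
  have hδ₄ : 0 < η / (2 * (C + 1)) := by positivity
  refine ⟨min (min δ₁ δ₂) (min δ₃ (η / (2 * (C + 1)))), by positivity, fun s t hst hts j => ?_⟩
  simp only [le_min_iff] at hts
  obtain ⟨⟨hts1, hts2⟩, hts3, hts4⟩ := hts
  have hst' : (0 : ℝ) ≤ (t : ℝ) - s := sub_nonneg.2 (by exact_mod_cast hst)
  set h : ℝ := (t : ℝ) - s with hh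
  set f := countMoment P g X τ s with hf
  have hfK : ‖f‖ ≤ K := hM.chain.norm_integral_mul_apply_le s hK fun ω => hg _
  have e1 : |(NormedSpace.exp (h • Q) *ᵥ f) j - f j - h * (Q *ᵥ f) j| ≤ η * h * K := by
    refine (norm_le_pi_norm (NormedSpace.exp (h • Q) *ᵥ f - f - h • (Q *ᵥ f)) j).trans ?_
    refine (hQ h (by rwa [abs_of_nonneg hst']) f).trans ?_
    rw [abs_of_nonneg hst']
    gcongr
  have e2 : |(NormedSpace.exp (h • Qmod Q lam k) *ᵥ f) j - f j - h * (Qmod Q lam k *ᵥ f) j|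
      ≤ η * h * K := by
    refine (norm_le_pi_norm (NormedSpace.exp (h • Qmod Q lam k) *ᵥ f - f
      - h • (Qmod Q lam k *ᵥ f)) j).trans ?_
    refine (hB h (by rwa [abs_of_nonneg hst']) f).trans ?_
    rw [abs_of_nonneg hst']
    gcongr
  have hBQ : (Qmod Q lam k *ᵥ f) j = (Q *ᵥ f) j - k * (lam j * f j) := by
    rw [Qmod, Matrix.sub_mulVec, Pi.sub_apply, Matrix.smul_mulVec, Pi.smul_apply,
      Matrix.mulVec_diagonal, smul_eq_mul]
  let G : Ω → ℝ := fun ω =>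
    (g (defaultCount τ s ω + 1) - g (defaultCount τ s ω)) * X s ω j
  have hG : Measurable[𝔽 s] G :=
    ((hM.measurable_comp_count (fun N => g (N + 1)) s).sub (hM.measurable_comp_count g s)).mul
      (hM.chain.measurable_apply s j)
  have hG' := hG.mono (𝔽.le s) le_rfl
  have hGK : ∀ ω, |G ω| ≤ 2 * K := fun ω =>
    hM.chain.abs_mul_apply_le s ω j
      ((abs_sub _ _).trans (by linarith [hg (defaultCount τ s ω), hg (defaultCount τ s ω + 1)]))
  have e3 := hN s t hst hts3 G (2 * K) hG hGK
  -- Here the system closes: the eigenfunction relation removes the factor n - N, and the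
  -- basis-vector property turns λᵀX_s into λ_j.
  have hGa : ∫ ω, G ω * defaultIntensity lam X τ s ω ∂P = -(k * (lam j * f j)) := by
    rw [hf, countMoment, ← integral_const_mul, ← integral_const_mul, ← integral_neg]
    refine integral_congr_ae (Eventually.of_forall fun ω => ?_)
    have h1 := hgk _ (defaultCount_le τ s ω)
    have h2 := hM.chain.dotProduct_mul_apply lam s ω j
    simp only [G, defaultIntensity, Real.toNNReal_coe]
    linear_combination (lam j * X s ω j) * h1 +
      (g (defaultCount τ s ω + 1) - g (defaultCount τ s ω)) * ((n : ℝ) - defaultCount τ s ω) * h2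
  rw [hGa] at e3
  have hdec : countMoment P g X τ t j
      = (NormedSpace.exp (h • Q) *ᵥ f) j
        + ∫ ω, G ω * ((defaultCount τ t ω : ℝ) - defaultCount τ s ω) ∂P
        + ∫ ω, incrementRemainder g X τ j s t ω ∂P := by
    have h1 := congrFun (hM.chain.integral_mul_apply hst (hM.measurable_comp_count g s)
      fun ω => hg _) j
    have h2 : Integrable (fun ω => G ω * ((defaultCount τ t ω : ℝ) - defaultCount τ s ω)) P :=
      ((hM.integrable_count t).sub (hM.integrable_count s)).bdd_mul (c := 2 * K)
        hG'.aestronglyMeasurable (Eventually.of_forall hGK)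
    have h3 := hM.integrable_incrementRemainder hg j hst
    rw [show (NormedSpace.exp (h • Q) *ᵥ f) j = _ from h1.symm,
      ← integral_add (hM.integrable_comp_count_mul_apply hg s t j) h2, ← integral_add
        (f := fun ω => g (defaultCount τ s ω) * X t ω j
          + G ω * ((defaultCount τ t ω : ℝ) - defaultCount τ s ω))
        ((hM.integrable_comp_count_mul_apply hg s t j).add h2) h3]
    refine integral_congr_ae (Eventually.of_forall fun ω => ?_)
    simp only [G, incrementRemainder]
    ring
  have e4 : |∫ ω, incrementRemainder g X τ j s t ω ∂P|
      ≤ ∫ ω, |incrementRemainder g X τ j s t ω| ∂P := abs_integral_le_integral_abs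
  have e5 : 2 * K * C * h ^ 2 ≤ η * h * K := by
    have h5 : h * (2 * (C + 1)) ≤ η := (le_div_iff₀ (by positivity)).1 hts4
    calc 2 * K * C * h ^ 2 ≤ (h * (2 * (C + 1))) * h * K := by
          have : 0 ≤ 2 * K * h ^ 2 := by positivity
          linarith
      _ ≤ η * h * K := by gcongr
  have e6 : 3 * (η * h * K) ≤ ε * h := by
    calc 3 * (η * h * K) ≤ 3 * η * (K + 1) * h := by
          have : 0 ≤ 3 * η * h := by positivity
          linarith
      _ ≤ ε * h := by gcongr
  rw [hdec]
  rw [hBQ] at e2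
  simp only [abs_le] at e1 e2 e3 e4 ⊢
  constructor <;> linarith [e1.1, e1.2, e2.1, e2.2, e3.1, e3.2, e4.1, e4.2]

/-- If `g` is an eigenfunction of the pure death generator, then `𝔼 [g(N_t) X_t]` solves a closed
linear differential equation. -/
theorem countMoment_eq (hM : IsModel P 𝔽 Q lam X τ) {K : ℝ} (hg : ∀ N, |g N| ≤ K) {k : ℕ}
    (hgk : ∀ N ≤ n, (g (N + 1) - g N) * ((n : ℝ) - N) = -(k * g N)) (T : ℝ≥0) :
    countMoment P g X τ T
      = NormedSpace.exp ((T : ℝ) • Qmod Q lam k) *ᵥ countMoment P g X τ 0 := by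
  set B := Qmod Q lam k
  set f := countMoment P g X τ
  obtain ⟨K', hK', hexp⟩ := exists_norm_exp_mulVec_le B T
  let R : ℕ → ℝ := fun m => ∑ j : Fin d, ∑ i ∈ Finset.range (m + 1),
    ∫ ω, |incrementRemainder g X τ j (grid T m i) (grid T m (i + 1)) ω| ∂P
  have hR : Tendsto R atTop (𝓝 0) := by
    simpa using tendsto_finsetSum Finset.univ fun j _ =>
      hM.tendsto_sum_integral_abs_incrementRemainder hg j T
  have hbound : ∀ ε > 0, ∀ᶠ m in atTop,
      ‖f T - NormedSpace.exp ((T : ℝ) • B) *ᵥ f 0‖ ≤ K' * (ε * T + R m) := by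
    intro ε hε
    obtain ⟨δ, hδ, hstep⟩ := hM.exists_abs_countMoment_sub_le hg hgk hε
    filter_upwards [(tendsto_mesh T).eventually (Iic_mem_nhds hδ)] with m hm
    -- `S` runs from exp(TB) f(0) to f(T). By the semigroup law each increment is a one-step error
    -- carried forward to time T by an exponential of norm bound `K'`.
    let S : ℕ → (Fin d → ℝ) := fun i =>
      NormedSpace.exp (((T : ℝ) - grid T m i) • B) *ᵥ f (grid T m i)
    have hS : f T - NormedSpace.exp ((T : ℝ) • B) *ᵥ f 0
        = ∑ i ∈ Finset.range (m + 1), (S (i + 1) - S i) := by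
      rw [Finset.sum_range_sub]
      simp [S]
    have hSi : ∀ i ∈ Finset.range (m + 1), ‖S (i + 1) - S i‖ ≤ K' * (ε * (T / (m + 1))
        + ∑ j : Fin d, ∫ ω, |incrementRemainder g X τ j (grid T m i) (grid T m (i + 1)) ω| ∂P) := by
      intro i hi
      have hle := grid_mono T m (Nat.le_succ i)
      have hsub := grid_succ_sub T m i
      have h1 : S (i + 1) - S i = NormedSpace.exp (((T : ℝ) - grid T m (i + 1)) • B) *ᵥ
          (f (grid T m (i + 1)) - NormedSpace.exp (((grid T m (i + 1) : ℝ) - grid T m i) • B) *ᵥ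
            f (grid T m i)) := by
        rw [Matrix.mulVec_sub, ← exp_add_smul_mulVec, sub_add_sub_cancel]
      have hT : (grid T m (i + 1) : ℝ) ≤ T := by
        exact_mod_cast grid_le T (Finset.mem_range.1 hi)
      rw [h1]
      refine (hexp _ ⟨sub_nonneg.2 hT, sub_le_self _ (NNReal.coe_nonneg _)⟩ _).trans ?_
      gcongr
      refine (pi_norm_le_iff_of_nonneg ?_).2 fun j => ?_
      · exact add_nonneg (by positivity) (Finset.sum_nonneg fun j _ =>
          integral_nonneg fun ω => abs_nonneg _)
      · refine (hstep _ _ hle (hsub.trans_le hm) j).trans ?_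
        rw [hsub]
        gcongr
        exact Finset.single_le_sum (f := fun j => ∫ ω, |incrementRemainder g X τ j (grid T m i)
          (grid T m (i + 1)) ω| ∂P) (fun j _ => integral_nonneg fun ω => abs_nonneg _)
          (Finset.mem_univ j)
    rw [hS]
    refine (norm_sum_le _ _).trans ((Finset.sum_le_sum hSi).trans_eq ?_)
    rw [← Finset.mul_sum, Finset.sum_add_distrib, Finset.sum_comm, Finset.sum_const,
      Finset.card_range, nsmul_eq_mul]
    congr 2
    push_cast
    field_simp
  -- First the mesh tends to 0 with `ε` fixed, which removes `R`; only then does `ε` tend to 0.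
  have hlim : ∀ ε > 0, ‖f T - NormedSpace.exp ((T : ℝ) • B) *ᵥ f 0‖ ≤ K' * (ε * T) := by
    intro ε hε
    refine ge_of_tendsto ?_ (hbound ε hε)
    simpa using (hR.const_add (ε * T)).const_mul K'
  have hzero : ‖f T - NormedSpace.exp ((T : ℝ) • B) *ᵥ f 0‖ ≤ 0 := by
    have h1 : Tendsto (fun ε : ℝ => K' * (ε * T)) (𝓝[>] 0) (𝓝 0) := by
      have : Continuous fun ε : ℝ => K' * (ε * T) := by fun_prop
      simpa using (this.tendsto 0).mono_left nhdsWithin_le_nhds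
    exact ge_of_tendsto h1 (eventually_mem_nhdsWithin.mono hlim)
  exact sub_eq_zero.1 (norm_le_zero_iff.1 hzero)

theorem countMoment_zero (hM : IsModel P 𝔽 Q lam X τ) (g : ℕ → ℝ) :
    countMoment P g X τ 0 = g 0 • initialVector P X := by
  funext j
  rw [Pi.smul_apply, initialVector, eval_integral (hM.chain.integrable_apply 0), smul_eq_mul,
    countMoment, ← integral_const_mul]
  refine integral_congr_ae ?_
  filter_upwards [hM.count_zero] with ω hω
  rw [hω]

end IsModel

/-! ### Binomial identities -/

/-- Removing one of the n - N survivors destroys the k-subsets containing it; summed over survivors,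
each k-subset is lost k times. At N = n the truncated subtraction is harmless because the factor n -
N is 0. -/
theorem choose_sub_succ_sub_mul {n N : ℕ} (hN : N ≤ n) (k : ℕ) :
    (((n - (N + 1)).choose k : ℝ) - ((n - N).choose k : ℝ)) * ((n : ℝ) - N)
      = -(k * ((n - N).choose k : ℝ)) := by
  obtain ⟨M, rfl⟩ := Nat.exists_eq_add_of_le hN
  rw [Nat.sub_add_eq, Nat.add_sub_cancel_left, Nat.cast_add, add_sub_cancel_left]
  cases M with
  | zero => cases k <;> simp
  | succ M =>
    rw [Nat.add_sub_cancel]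
    cases k with
    | zero => simp
    | succ k =>
      have h1 : ((M : ℝ) + 1) * M.choose k = (M + 1).choose (k + 1) * (k + 1) := by
        exact_mod_cast Nat.add_one_mul_choose_eq M k
      have h2 : ((M + 1).choose (k + 1) : ℝ) = M.choose k + M.choose (k + 1) := by
        exact_mod_cast Nat.choose_succ_succ M k
      push_cast
      linear_combination (-(M : ℝ) - 1) * h2 - h1

theorem pow_eq_sum_choose_sub {n N : ℕ} (hN : N ≤ n) (z : ℂ) :
    z ^ N = ∑ k ∈ Finset.range (n + 1),
      ((n - N).choose (n - k) : ℂ) * (z ^ k * (1 - z) ^ (n - k)) := by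
  obtain ⟨M, rfl⟩ := Nat.exists_eq_add_of_le hN
  -- The terms with k < N have a vanishing binomial coefficient; the others, shifted by N, are z^N
  -- times the expansion of (z + (1-z))^(n-N).
  rw [Nat.add_sub_cancel_left, Finset.range_eq_Ico,
    ← Finset.sum_Ico_consecutive _ (Nat.zero_le N) (by omega),
    Finset.sum_eq_zero (s := Finset.Ico 0 N), zero_add, Finset.sum_Ico_eq_sum_range]
  · have h1 : N + M + 1 - N = M + 1 := by omega
    have h2 := add_pow z (1 - z) M
    rw [add_sub_cancel, one_pow] at h2
    rw [h1]
    conv_lhs => rw [← mul_one (z ^ N), h2, Finset.mul_sum]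
    refine Finset.sum_congr rfl fun k hk => ?_
    have hk' : k ≤ M := Nat.lt_succ_iff.1 (Finset.mem_range.1 hk)
    rw [Nat.add_sub_add_left, Nat.choose_symm hk', pow_add]
    ring
  · intro k hk
    rw [Nat.choose_eq_zero_of_lt (by have := (Finset.mem_Ico.1 hk).2; omega)]
    simp

end MMDefault

end

/-! ### The expectation of exp(iuN) X -/

theorem mainTheorem5 {Ω : Type*} {mΩ : MeasurableSpace Ω} (P : Measure Ω) [IsProbabilityMeasure P]
    (𝔽 : Filtration ℝ≥0 mΩ) {d n : ℕ} (Q : Matrix (Fin d) (Fin d) ℝ) (lam : Fin d → ℝ)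
    (X : ℝ≥0 → Ω → (Fin d → ℝ)) (τ : Fin n → Ω → WithTop ℝ≥0)
    (hmodel : MMDefault.IsModel P 𝔽 Q lam X τ) (t : ℝ≥0) (u : ℝ) :
    Integrable (MMDefault.phiIntegrand X τ t u) P ∧
    MMDefault.phi P X τ t u =
      ∑ k ∈ Finset.range (n + 1),
        ((n.choose k : ℂ) * Complex.exp (Complex.I * (u : ℂ) * (k : ℂ)) *
            (1 - Complex.exp (Complex.I * (u : ℂ))) ^ (n - k)) •
          MMDefault.toComplex
            (NormedSpace.exp ((t : ℝ) • MMDefault.Qmod Q lam (n - k)) *ᵥ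
              MMDefault.initialVector P X) := by
  set z : ℂ := Complex.exp (Complex.I * (u : ℂ)) with hz
  have hzpow : ∀ k : ℕ, Complex.exp (Complex.I * (u : ℂ) * (k : ℂ)) = z ^ k := fun k => by
    rw [hz, ← Complex.exp_nat_mul, mul_comm]
  let g : ℕ → ℕ → ℝ := fun k N => ((n - N).choose k : ℝ)
  have hg : ∀ k N, |g k N| ≤ 2 ^ n := fun k N => by
    rw [Nat.abs_cast]
    exact_mod_cast (Nat.choose_le_two_pow _ _).trans (Nat.pow_le_pow_right two_pos (Nat.sub_le n N))
  have hint : ∀ k j, Integrable (fun ω =>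
      ((g k (MMDefault.defaultCount τ t ω) * X t ω j : ℝ) : ℂ)) P := fun k j =>
    (hmodel.integrable_comp_count_mul_apply (hg k) t t j).ofReal
  have hcoord : ∀ j, (fun ω => MMDefault.phiIntegrand X τ t u ω j) = fun ω =>
      ∑ k ∈ Finset.range (n + 1), (z ^ k * (1 - z) ^ (n - k)) *
        ((g (n - k) (MMDefault.defaultCount τ t ω) * X t ω j : ℝ) : ℂ) := fun j => by
    funext ω
    rw [MMDefault.phiIntegrand, hzpow, Pi.smul_apply, smul_eq_mul, MMDefault.toComplex,
      MMDefault.pow_eq_sum_choose_sub (MMDefault.defaultCount_le τ t ω), Finset.sum_mul]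
    refine Finset.sum_congr rfl fun k _ => ?_
    simp only [g]
    push_cast
    ring
  have hint_coord : ∀ j, Integrable (fun ω => MMDefault.phiIntegrand X τ t u ω j) P := fun j => by
    rw [hcoord]
    exact integrable_finsetSum _ fun k _ => (hint (n - k) j).const_mul _
  refine ⟨Integrable.of_eval hint_coord, funext fun j => ?_⟩
  rw [MMDefault.phi, eval_integral hint_coord, hcoord,
    integral_finsetSum _ fun k _ => (hint (n - k) j).const_mul _, Finset.sum_apply]
  refine Finset.sum_congr rfl fun k hk => ?_
  have hkn : k ≤ n := Nat.lt_succ_iff.1 (Finset.mem_range.1 hk)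
  have h1 := congrFun (hmodel.countMoment_eq (hg (n - k))
    (fun N hN => MMDefault.choose_sub_succ_sub_mul hN (n - k)) t) j
  rw [hmodel.countMoment_zero, Matrix.mulVec_smul, Pi.smul_apply, smul_eq_mul] at h1
  -- The coefficient C(n, k) of the formula is the initial value of the eigenfunction with index n -
  -- k.
  have h2 : g (n - k) 0 = n.choose k := by simp only [g, Nat.sub_zero, Nat.choose_symm hkn]
  have h3 : ∫ ω, ((g (n - k) (MMDefault.defaultCount τ t ω) * X t ω j : ℝ) : ℂ) ∂P
      = ((MMDefault.countMoment P (g (n - k)) X τ t j : ℝ) : ℂ) := integral_ofReal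
  rw [integral_const_mul, h3, h1, h2, hzpow, Pi.smul_apply, smul_eq_mul, MMDefault.toComplex]
  push_cast
  ring
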